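/- Let $K$ be a (possibly disconnected) compact Lie group and let $\Gamma$ be a finitely generated nilpotent group. Let $\mathrm{Hom}(\Gamma,K)$ be the space of all group homomorphisms $\Gamma\to K$, with the topology of pointwise convergence (equivalently, the subspace topology obtained by parametrizing homomorphisms by the images of a finite generating set of $\Gamma$), let $K$ act on it by conjugation, and give $\mathrm{Hom}(\Gamma,K)/K$ the quotient topology. Denote by $\mathrm{Hom}(\Gamma,K)_{\mathbf 1}$ the connected component of the trivial representation in $\mathrm{Hom}(\Gamma,K)$, and by $(\mathrm{Hom}(\Gamma,K)/K)_{\mathbf 1}$ the connected component of its class in $\mathrm{Hom}(\Gamma,K)/K$. Then $\mathrm{Hom}(\Gamma,K)_{\mathbf 1}$ is invariant under the action of $K$, and $$\mathrm{Hom}(\Gamma,K)_{\mathbf 1}/K=(\mathrm{Hom}(\Gamma,K)/K)_{\mathbf 1},$$ that is, the map $\mathrm{Hom}(\Gamma,K)_{\mathbf 1}/K\to \mathrm{Hom}(\Gamma,K)/K$ induced by the inclusion is a homeomorphism onto the component $(\mathrm{Hom}(\Gamma,K)/K)_{\mathbf 1}$. In particular, $\mathrm{Hom}(\Gamma,K)$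 is connected if and only if $\mathrm{Hom}(\Gamma,K)/K$ is connected. -/

import Mathlib

open scoped Manifold ContDiff

/-- The representation space `Hom(Γ, K)`: the set of all group homomorphisms from the discrete
group `Γ` to `K`. -/
def RepSpace (Γ K : Type*) [Group Γ] [Group K] : Type _ := Γ →* K

namespace RepSpace

variable {Γ K : Type*} [Group Γ] [Group K]

instance : FunLike (RepSpace Γ K) Γ K := inferInstanceAs (FunLike (Γ →* K) Γ K)

instance : MonoidHomClass (RepSpace Γ K) Γ K := inferInstanceAs (MonoidHomClass (Γ →* K) Γ K)

/-- The topology of pointwise convergence, i.e. the subspace topology from the product `K^Γ`.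
For a topological group `K` and any generating set `S` of `Γ`, it coincides with the subspace
topology obtained by embedding `Hom(Γ, K)` in `K^S` through the images of the generators. -/
instance [TopologicalSpace K] : TopologicalSpace (RepSpace Γ K) :=
  TopologicalSpace.induced (fun ρ => (ρ : Γ → K)) inferInstance

variable (Γ K) in
/-- The trivial representation, the base point of `Hom(Γ, K)`. -/
def trivialRep : RepSpace Γ K := (1 : Γ →* K)

/-- `K` acts on `Hom(Γ, K)` by conjugation: `(k • ρ) γ = k * ρ γ * k⁻¹`. -/
instance : MulAction K (RepSpace Γ K) where
  smul k ρ := (MulAut.conj k).toMonoidHom.comp (ρ : Γ →* K)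
  one_smul ρ := by
    refine DFunLike.ext _ _ fun γ => ?_
    change 1 * ρ γ * 1⁻¹ = ρ γ
    simp
  mul_smul k l ρ := by
    refine DFunLike.ext _ _ fun γ => ?_
    change (k * l) * ρ γ * (k * l)⁻¹ = k * (l * ρ γ * l⁻¹) * k⁻¹
    group

variable (Γ K) [TopologicalSpace K]

/-- The orbit space `Hom(Γ, K) / K` of the conjugation action. It carries the quotient
topology. -/
abbrev OrbitSpace : Type _ := MulAction.orbitRel.Quotient K (RepSpace Γ K)

/-- The class of the trivial representation, the base point of `Hom(Γ, K) / K`. -/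
def trivialClass : OrbitSpace Γ K := Quotient.mk _ (trivialRep Γ K)

/-- `Hom(Γ, K)_𝟙`: the connected component of the trivial representation in `Hom(Γ, K)`. -/
def trivialComponent : Set (RepSpace Γ K) := connectedComponent (trivialRep Γ K)

/-- `(Hom(Γ, K) / K)_𝟙`: the connected component of the class of the trivial representation in
the orbit space `Hom(Γ, K) / K`. -/
def orbitSpaceTrivialComponent : Set (OrbitSpace Γ K) := connectedComponent (trivialClass Γ K)

/-- Two elements of `Hom(Γ, K)_𝟙` are related when they are conjugate under an element of `K`. -/
def trivialComponentSetoid : Setoid (trivialComponent Γ K) :=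
  (MulAction.orbitRel K (RepSpace Γ K)).comap Subtype.val

/-- `Hom(Γ, K)_𝟙 / K`: the quotient of the subspace `Hom(Γ, K)_𝟙` by conjugation by elements of
`K`. It carries the quotient topology of the subspace topology. -/
abbrev TrivialComponentQuotient : Type _ := Quotient (trivialComponentSetoid Γ K)

/-- The natural map `Hom(Γ, K)_𝟙 / K → Hom(Γ, K) / K`, induced by the inclusion
`Hom(Γ, K)_𝟙 ⊆ Hom(Γ, K)`. -/
def trivialComponentQuotientMap : TrivialComponentQuotient Γ K → OrbitSpace Γ K :=
  Quotient.map' Subtype.val fun _ _ h => h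

end RepSpace

/-! The trivial representation is a fixed point of conjugation, and `Hom(Γ, K)` is compact
Hausdorff. There components are intersections of clopen sets, and the orbit map of a compact group
is both open and closed, so a clopen set around the fixed point yields a clopen set around its
class. Hence the preimage of the component of the class is exactly the component of the fixed point
(`mk_mem_connectedComponent_iff_of_fixed`). -/

section GroupAction

variable {G X : Type*} [Group G] [TopologicalSpace G] [CompactSpace G] [TopologicalSpace X]
  [MulAction G X] [ContinuousSMul G X]

/-- The connected component of a fixed point is invariant under the action. -/
theorem smul_mem_connectedComponent_of_fixed {G X : Type*} [Group G] [TopologicalSpace X]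
    [MulAction G X] [ContinuousConstSMul G X] {x₀ : X} (h₀ : ∀ g : G, g • x₀ = x₀)
    (g : G) {x : X} (hx : x ∈ connectedComponent x₀) : g • x ∈ connectedComponent x₀ := by
  have := (continuous_const_smul g).mapsTo_connectedComponent x₀ hx
  rwa [h₀] at this

/-- For a compact group acting on a compact Hausdorff space with a fixed point `x₀`, the points
lying over the component of the class of `x₀` are those of the component of `x₀`. -/
theorem mk_mem_connectedComponent_iff_of_fixed [IsTopologicalGroup G] [CompactSpace X] [T2Space X]
    {x₀ : X} (h₀ : ∀ g : G, g • x₀ = x₀) {x : X} :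
    Quotient.mk (MulAction.orbitRel G X) x ∈
        connectedComponent (Quotient.mk (MulAction.orbitRel G X) x₀) ↔
      x ∈ connectedComponent x₀ := by
  refine ⟨fun hx => ?_, fun hx => continuous_quotient_mk'.mapsTo_connectedComponent x₀ hx⟩
  rw [connectedComponent_eq_iInter_isClopen, Set.mem_iInter]
  rintro ⟨U, hU, hxU⟩
  -- The complement of the saturation of `Uᶜ` is a clopen neighbourhood of the class of `x₀`.
  have hV : IsClopen (Quotient.mk (MulAction.orbitRel G X) '' Uᶜ)ᶜ :=
    IsClopen.compl ⟨MulAction.isClosedMap_quotient (α := G) _ hU.compl.isClosed,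
      isOpenMap_quotient_mk'_mul _ hU.compl.isOpen⟩
  have hmem : Quotient.mk (MulAction.orbitRel G X) x₀ ∈
      (Quotient.mk (MulAction.orbitRel G X) '' Uᶜ)ᶜ := by
    rintro ⟨y, hy, hyx⟩
    -- The orbit of `x₀` is `{x₀}`, so `y = x₀`, which lies in `U`.
    obtain ⟨g, hg⟩ := MulAction.orbitRel_apply.1 (Quotient.exact hyx)
    exact hy (by rw [← hg]; simpa only [h₀] using hxU)
  by_contra hxn
  exact hV.connectedComponent_subset hmem hx ⟨x, hxn, rfl⟩

end GroupAction

namespace RepSpace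

variable {Γ K : Type*} [Group Γ] [Group K]

theorem smul_apply (k : K) (ρ : RepSpace Γ K) (γ : Γ) : (k • ρ) γ = k * ρ γ * k⁻¹ := rfl

theorem smul_trivialRep (k : K) : k • trivialRep Γ K = trivialRep Γ K := by
  refine DFunLike.ext _ _ fun γ => ?_
  change k * 1 * k⁻¹ = 1
  simp

variable [TopologicalSpace K]

theorem continuous_apply (γ : Γ) : Continuous fun ρ : RepSpace Γ K => ρ γ :=
  (_root_.continuous_apply γ).comp continuous_induced_dom

instance [IsTopologicalGroup K] : ContinuousSMul K (RepSpace Γ K) where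
  continuous_smul := by
    refine continuous_induced_rng.2 (continuous_pi fun γ => ?_)
    exact (continuous_fst.mul ((continuous_apply γ).comp continuous_snd)).mul continuous_fst.inv

instance [T2Space K] : T2Space (RepSpace Γ K) :=
  T2Space.of_injective_continuous (f := fun ρ : RepSpace Γ K => (ρ : Γ → K))
    DFunLike.coe_injective continuous_induced_dom

/-- Multiplicativity is a family of closed conditions on `Γ → K`; compactness of `Hom(Γ, K)` follows
from that of the product. -/
theorem isClosedEmbedding_coe [IsTopologicalGroup K] [T2Space K] :
    Topology.IsClosedEmbedding fun ρ : RepSpace Γ K => (ρ : Γ → K) where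
  eq_induced := rfl
  injective := DFunLike.coe_injective
  isClosed_range := by
    have : (Set.range fun ρ : RepSpace Γ K => (ρ : Γ → K))
        = ⋂ (a : Γ) (b : Γ), {f : Γ → K | f (a * b) = f a * f b} := by
      ext f
      simp only [Set.mem_range, Set.mem_iInter, Set.mem_ofPred_eq]
      constructor
      · rintro ⟨ρ, rfl⟩ a b
        exact map_mul ρ a b
      · exact fun h => ⟨MonoidHom.mk' f h, rfl⟩
    rw [this]
    exact isClosed_iInter fun a => isClosed_iInter fun b =>
      isClosed_eq (by fun_prop) (by fun_prop)

instance [IsTopologicalGroup K] [T2Space K] [CompactSpace K] : CompactSpace (RepSpace Γ K) :=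
  isClosedEmbedding_coe.compactSpace

variable (Γ K)

/-- Components are closed and the orbit map is closed, so the induced map is closed; a continuous
closed injection is an embedding. -/
theorem isClosedEmbedding_trivialComponentQuotientMap [IsTopologicalGroup K] [CompactSpace K] :
    Topology.IsClosedEmbedding (trivialComponentQuotientMap Γ K) := by
  refine .of_continuous_injective_isClosedMap ?_ ?_ ?_
  · exact (continuous_quotient_mk'.comp continuous_subtype_val).quotient_lift _
  · rintro ⟨a⟩ ⟨b⟩ hab
    exact Quotient.sound (Quotient.exact hab :)
  · intro F hF
    have hF' : IsClosed (Subtype.val '' (Quotient.mk (trivialComponentSetoid Γ K) ⁻¹' F)) :=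
      isClosed_connectedComponent.isClosedMap_subtype_val _ (hF.preimage continuous_quotient_mk')
    have himage := MulAction.isClosedMap_quotient (α := K) _ hF'
    -- By surjectivity of the quotient map, `F` is the image of its own preimage.
    convert himage using 1
    rw [Set.image_image]
    conv_lhs => rw [← Set.image_preimage_eq F Quotient.mk_surjective, Set.image_image]
    rfl

theorem range_trivialComponentQuotientMap [IsTopologicalGroup K] [T2Space K] [CompactSpace K] :
    Set.range (trivialComponentQuotientMap Γ K) = orbitSpaceTrivialComponent Γ K := by
  ext q
  constructor
  · rintro ⟨⟨a⟩, rfl⟩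
    exact (mk_mem_connectedComponent_iff_of_fixed smul_trivialRep).2 a.2
  · obtain ⟨ρ, rfl⟩ := Quotient.mk_surjective q
    intro h
    exact ⟨Quotient.mk _ ⟨ρ, (mk_mem_connectedComponent_iff_of_fixed smul_trivialRep).1 h⟩, rfl⟩

theorem connectedSpace_iff_connectedSpace_orbitSpace [IsTopologicalGroup K] [T2Space K]
    [CompactSpace K] : ConnectedSpace (RepSpace Γ K) ↔ ConnectedSpace (OrbitSpace Γ K) := by
  refine ⟨fun _ => Quotient.mk_surjective.connectedSpace continuous_quotient_mk', fun _ => ?_⟩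
  refine connectedSpace_iff_connectedComponent.2 ⟨trivialRep Γ K, Set.eq_univ_of_forall fun ρ => ?_⟩
  -- Connectedness is lifted from the quotient: every class lies in the component of the trivial
  -- one.
  refine (mk_mem_connectedComponent_iff_of_fixed (G := K) smul_trivialRep).1 ?_
  rw [PreconnectedSpace.connectedComponent_eq_univ]
  trivial

end RepSpace

theorem lemma3p3
    {E : Type*} [NormedAddCommGroup E] [NormedSpace ℝ E] [FiniteDimensional ℝ E]
    {K : Type*} [Group K] [TopologicalSpace K] [T2Space K] [CompactSpace K]
    [ChartedSpace E K] [LieGroup 𝓘(ℝ, E) ∞ K]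
    {Γ : Type*} [Group Γ] [Group.FG Γ] [Group.IsNilpotent Γ] :
    (∀ (k : K), ∀ ρ ∈ RepSpace.trivialComponent Γ K, k • ρ ∈ RepSpace.trivialComponent Γ K) ∧
    Topology.IsEmbedding (RepSpace.trivialComponentQuotientMap Γ K) ∧
    Set.range (RepSpace.trivialComponentQuotientMap Γ K)
      = RepSpace.orbitSpaceTrivialComponent Γ K ∧
    (ConnectedSpace (RepSpace Γ K) ↔ ConnectedSpace (RepSpace.OrbitSpace Γ K)) := by
  have : IsTopologicalGroup K := topologicalGroup_of_lieGroup 𝓘(ℝ, E) ∞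
  exact ⟨fun k _ hρ => smul_mem_connectedComponent_of_fixed RepSpace.smul_trivialRep k hρ,
    (RepSpace.isClosedEmbedding_trivialComponentQuotientMap Γ K).isEmbedding,
    RepSpace.range_trivialComponentQuotientMap Γ K,
    RepSpace.connectedSpace_iff_connectedSpace_orbitSpace Γ K⟩
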